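/- **Local equivariant curves.** Let $G$ be a finite group acting freely on a finite set $I$, and let $\bar I \subset I$ be a system of representatives of the orbits. Let $\chi,\upsilon,\beta\colon G\to\mathbb{C}^\times$ be characters with $\beta^2=1$, and let $\sqrt\chi\colon G\to\mathbb{C}^\times$ be a function with $(\sqrt\chi)_\gamma^2=\chi_\gamma$ for all $\gamma$ and $(\sqrt\chi)_e=1$. A *local $G$-equivariant spectral curve* $\mathcal{S}_G$ with these data is the formal curve $\bigsqcup_{i\in I}\operatorname{Spec}\mathbb{C}[[\zeta_i]]$ together with $$x(\zeta_i)=\zeta_i^2+\alpha_i,\qquad y(\zeta_i)=\sum_{k\ge0}h^i_k\zeta_i^k ,$$ $$B(\zeta_{i,1},\zeta_{j,2})=\frac{\sum_{\gamma\in G}\beta_\gamma\delta_{i,\gamma j}}{|G|}\,\frac{dt_{i,1}\,dt_{j,2}}{(t_{i,1}-t_{j,2})^2}+\sum_{k,l\ge0}B^{i,j}_{k,l}\,\zeta_{i,1}^k\zeta_{j,2}^l\,d\zeta_{i,1}d\zeta_{j,2},$$ where $t_{\gamma i}=\zeta_{\gamma i}/(\sqrt\chi)_\gamma$ for $i\in\bar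 I$, $\gamma\in G$. The coefficients satisfy, for $i,j\in\bar I$ and $\gamma,\eta\in G$, $$h^{\gamma i}_k=\upsilon_\gamma(\sqrt\chi)_\gamma^{-k}h^i_k,\qquad B^{\gamma i,\eta j}_{k,l}=B^{\eta j,\gamma i}_{l,k}=\beta_{\gamma\eta}(\sqrt\chi)_\gamma^{-k-1}(\sqrt\chi)_\eta^{-l-1}B^{i,j}_{k,l}.$$ We assume that $y(\zeta_i)\neq y(-\zeta_i)$ for every $i\in I$ (for example, that $h^i_1\ne0$), so that the recursion kernel below is defined. **Topological recursion.** The correlators $\omega_{g,n+1}$, for $g,n\ge0$ and $2g-2+(n+1)>0$, are formal meromorphic multidifferentials with poles only where some coordinate vanishes. They are defined by $\omega_{0,2}=B$ and recursively by $$\omega_{g,n+1}(\zeta_0,\dots,\zeta_n)=\sum_{i\in I}\operatorname*{Res}_{\zeta_i\to0}K(\zeta_0,\zeta_i)\Big(\omega_{g-1,n+2}(\zeta_i,-\zeta_i,\zeta_1,\dots,\zeta_n)+\sum_{\substack{g_1+g_2=g\\ J_1\sqcup J_2=\{1,\dots,n\}}}^{\text{no }(0,1)}\omega_{g_1,1+|J_1|}(\zeta_i,\zeta_{J_1})\,\omega_{g_2,1+|J_2|}(-\zeta_i,\zeta_{J_2})\Big),$$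 $$K(\zeta_0,\zeta_i)=\frac{\frac12\int_{-\zeta_i}^{\zeta_i}B(\zeta_0,\cdot)}{\big(y(\zeta_i)-y(-\zeta_i)\big)\,dx(\zeta_i)} .$$ Here the term with $\omega_{g-1,n+2}$ is absent for $g=0$, the terms containing $\omega_{0,1}$ are omitted, and the residue is taken with $\zeta_i$ small compared to $\zeta_0,\dots,\zeta_n$. **Quotient.** The quotient (reduced) curve $\mathcal{S}_{\mathrm{red}}$ is $\bigsqcup_{i\in\bar I}\operatorname{Spec}\mathbb{C}[[\zeta_i]]$ with $x$, $y$, $B$ restricted to it. The reduced correlators $\omega^{\mathrm{red}}_{g,n}$ are obtained from it by the same recursion, with the sum over $i\in\bar I$. They are extended to all components $i\in I$ by $$\omega^{\mathrm{red}}_{g,n}(\dots,\zeta_{\gamma i},\dots)=\beta_\gamma\,\omega^{\mathrm{red}}_{g,n}(\dots,\zeta_i,\dots)\qquad(i\in\bar I,\ \gamma\in G)$$ in each variable, under the substitution $\zeta_{\gamma i}=(\sqrt\chi)_\gamma\zeta_i$. **Proposition.** Let $\mathcal{S}_G$ be a local $G$-equivariant spectral curve, and let $g\ge0$, $n\ge1$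 with $2g-2+n>0$. If $\chi\cdot\upsilon\neq\beta$, then $\omega_{g,n}=0$. If $\chi\cdot\upsilon=\beta$, then $$\omega_{g,n}=|G|^{2g-2+n}\,\omega^{\mathrm{red}}_{g,n},$$ where $\omega^{\mathrm{red}}_{g,n}$ is the extended reduced correlator. -/

import Mathlib

/-! Topological recursion on formal local spectral curves
`⨆ᵢ Spec ℂ⟦ζᵢ⟧`, with and without the action of a finite group. -/

namespace LocalTR

noncomputable section

/-! ### Laurent series in the residue variable -/

/-- `f` vanishes to order at least `N`. -/
def VanishBelow (f : LaurentSeries ℂ) (N : ℤ) : Prop := ∀ p < N, f.coeff p = 0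

theorem VanishBelow.mono {f : LaurentSeries ℂ} {a b : ℤ} (hf : VanishBelow f a) (h : b ≤ a) :
    VanishBelow f b := fun p hp => hf p (lt_of_lt_of_le hp h)

theorem VanishBelow.zero (N : ℤ) : VanishBelow 0 N := fun _ _ => rfl

theorem VanishBelow.add {f g : LaurentSeries ℂ} {a : ℤ} (hf : VanishBelow f a)
    (hg : VanishBelow g a) : VanishBelow (f + g) a := fun p hp => by
  simp [hf p hp, hg p hp]

theorem VanishBelow.neg {f : LaurentSeries ℂ} {a : ℤ} (hf : VanishBelow f a) :
    VanishBelow (-f) a := fun p hp => by simp [hf p hp]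

theorem VanishBelow.sum {ι : Type*} {s : Finset ι} {f : ι → LaurentSeries ℂ} {a : ℤ}
    (hf : ∀ x ∈ s, VanishBelow (f x) a) : VanishBelow (∑ x ∈ s, f x) a :=
  Finset.sum_induction f (fun g => VanishBelow g a) (fun _ _ => VanishBelow.add)
    (VanishBelow.zero a) hf

theorem VanishBelow.mul {f g : LaurentSeries ℂ} {a b : ℤ} (hf : VanishBelow f a)
    (hg : VanishBelow g b) : VanishBelow (f * g) (a + b) := fun p hp => by
  rw [HahnSeries.coeff_mul]
  refine Finset.sum_eq_zero fun x hx => ?_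
  rw [Finset.mem_antidiagonal] at hx
  rcases lt_or_ge x.1 a with h | h
  · rw [hf _ h, zero_mul]
  · rw [hg x.2 (by omega), mul_zero]

theorem exists_vanishBelow (f : LaurentSeries ℂ) : ∃ N, VanishBelow f N :=
  ⟨f.order, fun _ hp => HahnSeries.coeff_eq_zero_of_lt_order hp⟩

theorem vanishBelow_ofPowerSeries {f : PowerSeries ℂ} {N : ℕ}
    (hf : ∀ k < N, PowerSeries.coeff k f = 0) :
    VanishBelow (HahnSeries.ofPowerSeries ℤ ℂ f) N := fun p hp => by
  rcases lt_or_ge p 0 with h | h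
  · rw [HahnSeries.ofPowerSeries_apply]
    refine HahnSeries.embDomain_of_notMem_range ?_
    rintro ⟨k, rfl⟩
    simp at h
    omega
  · lift p to ℕ using h
    rw [HahnSeries.ofPowerSeries_apply_coeff]
    exact hf p (by exact_mod_cast hp)

/-- The Laurent series `f(-ζ)`. -/
def negArg (f : LaurentSeries ℂ) : LaurentSeries ℂ where
  coeff p := (-1) ^ p * f.coeff p
  isPWO_support' := f.isPWO_support.mono fun p hp h => hp (by simp [h])

theorem VanishBelow.negArg {f : LaurentSeries ℂ} {a : ℤ} (hf : VanishBelow f a) :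
    VanishBelow (negArg f) a := fun p hp => by simp [LocalTR.negArg, hf p hp]

/-- `∫_{-ζ}^{ζ} f(w) dw = F(ζ) - F(-ζ)` for the formal primitive `F` of `f`. -/
def symIntegral (f : PowerSeries ℂ) : PowerSeries ℂ :=
  let F : PowerSeries ℂ :=
    PowerSeries.mk fun k => if k = 0 then 0 else PowerSeries.coeff (k - 1) f / k
  F - PowerSeries.rescale (-1) F

/-! ### Multidifferentials -/

/-- A formal meromorphic `n`-differential on `(⨆ᵢ Spec ℂ⟦ζᵢ⟧)ⁿ` with poles only along the loci
where one of the coordinates vanishes.  On the component `(i₁, …, iₙ)` it is `f dζ₁ ⋯ dζₙ` with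
`f ∈ ℂ⟦ζ₁, …, ζₙ⟧[ζ₁⁻¹, …, ζₙ⁻¹]`, and `coeff ((i₁, m₁), …, (iₙ, mₙ))` is the coefficient of
`ζ₁^m₁ ⋯ ζₙ^mₙ` in `f`.  The condition `bdd` says that the orders of the poles are bounded. -/
@[ext]
structure MultiDiff (I : Type*) (n : ℕ) where
  coeff : (Fin n → I × ℤ) → ℂ
  bdd : ∃ N : ℤ, ∀ v, (∃ j, (v j).2 < N) → coeff v = 0

instance {I : Type*} {n : ℕ} : Zero (MultiDiff I n) := ⟨⟨fun _ => 0, 0, fun _ _ => rfl⟩⟩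

namespace MultiDiff

variable {I : Type*} {n : ℕ}

/-- The Laurent series `∑ₚ ω((i, p), v) ζ^p`: the part of `ω(ζᵢ, ζ₁, …, ζₙ) / dζᵢ` with
monomial `v` in the remaining variables. -/
def series (ω : MultiDiff I (n + 1)) (i : I) (v : Fin n → I × ℤ) : LaurentSeries ℂ :=
  HahnSeries.ofSuppBddBelow (fun p : ℤ => ω.coeff (Fin.cons (i, p) v)) (by
    obtain ⟨N, hN⟩ := ω.bdd
    refine ⟨N, fun p hp => ?_⟩
    by_contra h
    exact hp (hN _ ⟨0, by simpa using h⟩))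

/-- The part of `ω(ζᵢ, -ζᵢ, ζ₁, …, ζₙ) / (dζᵢ)²` with monomial `v` in the remaining variables.
The sign is that of `(-ζ)^q d(-ζ) = (-1)^(q+1) ζ^q dζ`.  The sum has finite support. -/
def diag (ω : MultiDiff I (n + 2)) (i : I) (v : Fin n → I × ℤ) : LaurentSeries ℂ :=
  HahnSeries.ofSuppBddBelow
    (fun m : ℤ => ∑ᶠ p : ℤ, (-1) ^ (m - p + 1) *
      ω.coeff (Fin.cons (i, p) (Fin.cons (i, m - p) v : Fin (n + 1) → I × ℤ))) (by
    obtain ⟨N, hN⟩ := ω.bdd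
    refine ⟨2 * N, fun m hm => ?_⟩
    by_contra h
    refine hm (finsum_eq_zero_of_forall_eq_zero fun p => ?_)
    rcases lt_or_ge p N with hp | hp
    · rw [hN _ ⟨0, by simpa using hp⟩, mul_zero]
    · rw [hN _ ⟨1, ?_⟩, mul_zero]
      change (m - p) < N
      omega)

end MultiDiff

/-- A family of Laurent series in the residue variable, indexed by the monomials in the remaining
variables, such that only boundedly negative powers contribute to each order. -/
structure Tame {I : Type*} {n : ℕ} (F : (Fin n → I × ℤ) → LaurentSeries ℂ) : Prop where
  order : ∃ N, ∀ v, VanishBelow (F v) N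
  escape : ∀ M : ℤ, ∃ N : ℤ, ∀ v, (∃ j, (v j).2 < N) → VanishBelow (F v) M

namespace Tame

variable {I : Type*} {n : ℕ}

theorem zero : Tame (fun _ : Fin n → I × ℤ => (0 : LaurentSeries ℂ)) :=
  ⟨⟨0, fun _ => .zero 0⟩, fun M => ⟨0, fun _ _ => .zero M⟩⟩

theorem const (f : LaurentSeries ℂ) : Tame (fun _ : Fin 0 → I × ℤ => f) := by
  obtain ⟨N, hN⟩ := exists_vanishBelow f
  exact ⟨⟨N, fun _ => hN⟩, fun M => ⟨0, fun _ ⟨j, _⟩ => j.elim0⟩⟩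

theorem add {F F' : (Fin n → I × ℤ) → LaurentSeries ℂ} (hF : Tame F) (hF' : Tame F') :
    Tame (fun v => F v + F' v) := by
  obtain ⟨a, ha⟩ := hF.order
  obtain ⟨b, hb⟩ := hF'.order
  refine ⟨⟨min a b, fun v => ((ha v).mono (min_le_left _ _)).add
    ((hb v).mono (min_le_right _ _))⟩, fun M => ?_⟩
  obtain ⟨a, ha⟩ := hF.escape M
  obtain ⟨b, hb⟩ := hF'.escape M
  exact ⟨min a b, fun v ⟨j, hj⟩ => (ha v ⟨j, lt_of_lt_of_le hj (min_le_left _ _)⟩).add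
    (hb v ⟨j, lt_of_lt_of_le hj (min_le_right _ _)⟩)⟩

theorem sum {ι : Type*} (s : Finset ι) {F : ι → (Fin n → I × ℤ) → LaurentSeries ℂ}
    (hF : ∀ x, Tame (F x)) : Tame (fun v => ∑ x ∈ s, F x v) := by
  classical
  induction s using Finset.induction_on with
  | empty => simpa using zero
  | insert a s ha ih => simpa [Finset.sum_insert ha] using (hF a).add ih

theorem neg {F : (Fin n → I × ℤ) → LaurentSeries ℂ} (hF : Tame F) : Tame (fun v => -F v) := by
  obtain ⟨a, ha⟩ := hF.order
  refine ⟨⟨a, fun v => (ha v).neg⟩, fun M => ?_⟩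
  obtain ⟨b, hb⟩ := hF.escape M
  exact ⟨b, fun v hv => (hb v hv).neg⟩

theorem negArg {F : (Fin n → I × ℤ) → LaurentSeries ℂ} (hF : Tame F) :
    Tame (fun v => negArg (F v)) := by
  obtain ⟨a, ha⟩ := hF.order
  refine ⟨⟨a, fun v => (ha v).negArg⟩, fun M => ?_⟩
  obtain ⟨b, hb⟩ := hF.escape M
  exact ⟨b, fun v hv => (hb v hv).negArg⟩

/-- Products over complementary sets of variables. -/
theorem mul {m l : ℕ} {F : (Fin m → I × ℤ) → LaurentSeries ℂ}
    {F' : (Fin l → I × ℤ) → LaurentSeries ℂ} (hF : Tame F) (hF' : Tame F')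
    (e : Fin m → Fin n) (e' : Fin l → Fin n) (he : ∀ j, (∃ a, e a = j) ∨ ∃ a, e' a = j) :
    Tame (fun v : Fin n → I × ℤ => F (v ∘ e) * F' (v ∘ e')) := by
  obtain ⟨a, ha⟩ := hF.order
  obtain ⟨b, hb⟩ := hF'.order
  refine ⟨⟨a + b, fun v => (ha _).mul (hb _)⟩, fun M => ?_⟩
  obtain ⟨a', ha'⟩ := hF.escape (M - b)
  obtain ⟨b', hb'⟩ := hF'.escape (M - a)
  refine ⟨min a' b', fun v ⟨j, hj⟩ => ?_⟩
  rcases he j with ⟨x, rfl⟩ | ⟨x, rfl⟩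
  · exact ((ha' (v ∘ e) ⟨x, lt_of_lt_of_le hj (min_le_left _ _)⟩).mul (hb _)).mono (by omega)
  · exact ((ha _).mul (hb' (v ∘ e') ⟨x, lt_of_lt_of_le hj (min_le_right _ _)⟩)).mono (by omega)

theorem series (ω : MultiDiff I (n + 1)) (i : I) : Tame (ω.series i) := by
  obtain ⟨N, hN⟩ := ω.bdd
  refine ⟨⟨N, fun v p hp => hN _ ⟨0, by simpa using hp⟩⟩,
    fun M => ⟨N, fun v ⟨j, hj⟩ p _ => hN _ ⟨j.succ, by simpa using hj⟩⟩⟩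

theorem diag (ω : MultiDiff I (n + 2)) (i : I) : Tame (ω.diag i) := by
  obtain ⟨N, hN⟩ := ω.bdd
  refine ⟨⟨2 * N, fun v m hm => finsum_eq_zero_of_forall_eq_zero fun p => ?_⟩,
    fun M => ⟨N, fun v ⟨j, hj⟩ m _ => finsum_eq_zero_of_forall_eq_zero fun p => ?_⟩⟩
  · rcases lt_or_ge p N with hp | hp
    · rw [hN _ ⟨0, by simpa using hp⟩, mul_zero]
    · rw [hN _ ⟨1, ?_⟩, mul_zero]
      change (m - p) < N
      omega
  · rw [hN _ ⟨j.succ.succ, by simpa using hj⟩, mul_zero]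

end Tame

/-! ### Local spectral curves and topological recursion -/

/-- A local spectral curve `⨆ᵢ Spec ℂ⟦ζᵢ⟧` with

* `x(ζᵢ) = ζᵢ² + αᵢ`,
* `y(ζᵢ) = ∑ₖ hᵢₖ ζᵢᵏ`,
* `B(ζᵢ, ζⱼ) = cᵢⱼ dtᵢ dtⱼ / (tᵢ - tⱼ)² + ∑ₖₗ Bᵢⱼₖₗ ζᵢᵏ ζⱼˡ dζᵢ dζⱼ`, symmetric, where `tᵢ = ζᵢ / τᵢ`.

The usual local spectral curves have `τ = 1` and `c` a multiple of the identity matrix; in general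
`B` has double poles also between different components. -/
structure Curve (I : Type*) where
  α : I → ℂ
  h : I → ℕ → ℂ
  τ : I → ℂˣ
  c : I → I → ℂ
  jump : I → I → ℕ → ℕ → ℂ
  c_symm : ∀ i j, c i j = c j i
  jump_symm : ∀ i j k l, jump i j k l = jump j i l k

namespace Curve

variable {I : Type*} (S : Curve I)

/-- `x` on the component `i`. -/
def x (i : I) : PowerSeries ℂ := PowerSeries.X ^ 2 + PowerSeries.C (S.α i)

/-- `y` on the component `i`. -/
def y (i : I) : PowerSeries ℂ := PowerSeries.mk (S.h i)

/-- Restriction of all the data along a map of index sets. -/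
def comap {J : Type*} (f : J → I) : Curve J where
  α i := S.α (f i)
  h i := S.h (f i)
  τ i := S.τ (f i)
  c i j := S.c (f i) (f j)
  jump i j := S.jump (f i) (f j)
  c_symm _ _ := S.c_symm _ _
  jump_symm _ _ := S.jump_symm _ _

/-- The coefficient of `ζₐ^m dζₐ`, where `e = (a, m)`, in `B(ζₐ, ζᵢ) / dζᵢ = B(ζᵢ, ζₐ) / dζᵢ`, as a
power series in `ζᵢ`.  As always under a residue at `ζᵢ → 0`, the expansion is for `ζᵢ` small
compared to `ζₐ`, so that
`dtₐ dtᵢ / (tₐ - tᵢ)² = ∑ₖ (k + 1) (τₐ / τᵢ)^(k+1) ζₐ^(-k-2) ζᵢ^k dζₐ dζᵢ`. -/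
def bSeries (e : I × ℤ) (i : I) : PowerSeries ℂ :=
  PowerSeries.mk fun k =>
    (if e.2 = -(k : ℤ) - 2 then S.c e.1 i * (k + 1) * ((S.τ e.1 : ℂ) / S.τ i) ^ (k + 1) else 0) +
    (if 0 ≤ e.2 then S.jump e.1 i e.2.toNat k else 0)

/-- `B(ζᵢ, -ζᵢ) / (dζᵢ)²`; the polar part is `dt d(-t) / (t - (-t))² = -(dζ)² / (4 ζ²)`. -/
def bDiag (i : I) : LaurentSeries ℂ :=
  HahnSeries.single (-2) (-(S.c i i) / 4) +
  HahnSeries.ofPowerSeries ℤ ℂ (PowerSeries.mk fun m =>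
    ∑ p ∈ Finset.HasAntidiagonal.antidiagonal m, (-1) ^ (p.2 + 1) * S.jump i i p.1 p.2)

/-- The recursion kernel `K(ζ₀, ζᵢ) = ½ ∫_{-ζᵢ}^{ζᵢ} B(ζ₀, ·) / ((y(ζᵢ) - y(-ζᵢ)) dx(ζᵢ))`:
the coefficient of `ζₐ^m dζₐ`, where `e = (a, m)` and `ζ₀` lies in the component `a`, as a Laurent
series in `ζᵢ` (to be multiplied by `1 / dζᵢ`). -/
def kernel (e : I × ℤ) (i : I) : LaurentSeries ℂ :=
  HahnSeries.ofPowerSeries ℤ ℂ (PowerSeries.C (1 / 2) * symIntegral (S.bSeries e i)) /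
  HahnSeries.ofPowerSeries ℤ ℂ
    ((S.y i - PowerSeries.rescale (-1) (S.y i)) * PowerSeries.derivative ℂ (S.x i))

variable (ω : ∀ (_ n : ℕ), MultiDiff I (n + 1))

/-- `ω_{g,1+n}(ζᵢ, ζ₁, …, ζₙ) / dζᵢ`, the part with monomial `v` in `ζ₁, …, ζₙ`, when `ω g n` is
the stable `ω_{g,n+1}`.  Here `ω_{0,2} = B`, and `ω_{0,1}` is left out of the recursion. -/
def leg : (g n : ℕ) → I → (Fin n → I × ℤ) → LaurentSeries ℂ
  | 0, 0, _, _ => 0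
  | 0, 1, i, v => HahnSeries.ofPowerSeries ℤ ℂ (S.bSeries (v 0) i)
  | 0, n + 2, i, v => (ω 0 (n + 2)).series i v
  | g + 1, n, i, v => (ω (g + 1) n).series i v

/-- `ω_{g-1,n+2}(ζᵢ, -ζᵢ, ζ₁, …, ζₙ) / (dζᵢ)²`, the part with monomial `v` in `ζ₁, …, ζₙ`. -/
def loop : (g n : ℕ) → I → (Fin n → I × ℤ) → LaurentSeries ℂ
  | 0, _, _, _ => 0
  | 1, 0, i, _ => S.bDiag i
  | 1, n + 1, i, v => (ω 0 (n + 2)).diag i v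
  | g + 2, n, i, v => (ω (g + 1) (n + 1)).diag i v

/-- The bracket of the recursion, divided by `(dζᵢ)²`:
`ω_{g-1,n+2}(ζᵢ, -ζᵢ, ζ₁, …, ζₙ) + ∑ ω_{g₁,1+|J|}(ζᵢ, ζ_J) ω_{g₂,1+|Jᶜ|}(-ζᵢ, ζ_{Jᶜ})`
over `g₁ + g₂ = g` and `J ⊆ {1, …, n}`. -/
def bracket (g n : ℕ) (i : I) (v : Fin n → I × ℤ) : LaurentSeries ℂ :=
  S.loop ω g n i v +
  ∑ p ∈ Finset.HasAntidiagonal.antidiagonal g, ∑ J : Finset (Fin n),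
    S.leg ω p.1 J.card i (v ∘ J.orderEmbOfFin rfl) *
      -negArg (S.leg ω p.2 Jᶜ.card i (v ∘ Jᶜ.orderEmbOfFin rfl))

theorem bSeries_coeff_eq_zero {e : I × ℤ} {i : I} {N k : ℕ} (he : e.2 < -(N : ℤ) - 2)
    (hk : k ≤ N) : PowerSeries.coeff k (S.bSeries e i) = 0 := by
  rw [bSeries, PowerSeries.coeff_mk, if_neg (by omega), if_neg (by omega), add_zero]

theorem tame_bSeries (i : I) : Tame (fun v : Fin 1 → I × ℤ =>
    HahnSeries.ofPowerSeries ℤ ℂ (S.bSeries (v 0) i)) := by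
  refine ⟨⟨0, fun v => vanishBelow_ofPowerSeries (N := 0) (by simp)⟩,
    fun M => ⟨-(M.toNat : ℤ) - 2, fun v ⟨j, hj⟩ => ?_⟩⟩
  refine (vanishBelow_ofPowerSeries (N := M.toNat) fun k hk => ?_).mono (by omega)
  obtain rfl : j = 0 := Subsingleton.elim _ _
  exact S.bSeries_coeff_eq_zero hj hk.le

theorem tame_kernel (i : I) : Tame (fun v : Fin 1 → I × ℤ => S.kernel (v 0) i) := by
  have h : Tame (fun v : Fin 1 → I × ℤ => HahnSeries.ofPowerSeries ℤ ℂ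
      (PowerSeries.C (1 / 2) * symIntegral (S.bSeries (v 0) i))) := by
    refine ⟨⟨0, fun v => vanishBelow_ofPowerSeries (N := 0) (by simp)⟩,
      fun M => ⟨-(M.toNat : ℤ) - 2, fun v ⟨j, hj⟩ => ?_⟩⟩
    refine (vanishBelow_ofPowerSeries (N := M.toNat) fun k hk => ?_).mono (by omega)
    obtain rfl : j = 0 := Subsingleton.elim _ _
    have := S.bSeries_coeff_eq_zero (i := i) hj (k := k - 1) (by omega)
    simp [symIntegral, PowerSeries.coeff_C_mul, PowerSeries.coeff_rescale, this]
  have h' := h.mul (Tame.const (I := I) (HahnSeries.ofPowerSeries ℤ ℂ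
    ((S.y i - PowerSeries.rescale (-1) (S.y i)) * PowerSeries.derivative ℂ (S.x i)))⁻¹)
    id Fin.elim0 (fun j => Or.inl ⟨j, rfl⟩)
  simpa only [kernel, div_eq_mul_inv, Function.comp_id] using h'

theorem tame_leg (g n : ℕ) (i : I) : Tame (S.leg ω g n i) := by
  match g, n with
  | 0, 0 => exact Tame.zero
  | 0, 1 => exact S.tame_bSeries i
  | 0, n + 2 => exact Tame.series _ i
  | g + 1, n => exact Tame.series _ i

theorem tame_loop (g n : ℕ) (i : I) : Tame (S.loop ω g n i) := by
  match g, n with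
  | 0, _ => exact Tame.zero
  | 1, 0 => exact Tame.const _
  | 1, n + 1 => exact Tame.diag _ i
  | g + 2, n => exact Tame.diag _ i

theorem tame_bracket (g n : ℕ) (i : I) : Tame (S.bracket ω g n i) := by
  refine (S.tame_loop ω g n i).add (Tame.sum _ fun p => Tame.sum _ fun J => ?_)
  refine (S.tame_leg ω p.1 J.card i).mul (S.tame_leg ω p.2 Jᶜ.card i).negArg.neg
    (J.orderEmbOfFin rfl) (Jᶜ.orderEmbOfFin rfl) fun j => ?_
  have key (K : Finset (Fin n)) (hj : j ∈ K) : ∃ a, K.orderEmbOfFin rfl a = j := by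
    rw [← Set.mem_range, Finset.range_orderEmbOfFin]
    exact hj
  by_cases hj : j ∈ J
  · exact Or.inl (key J hj)
  · exact Or.inr (key Jᶜ (by simpa using hj))

theorem bracket_congr {ω ω' : ∀ (_ n : ℕ), MultiDiff I (n + 1)} {g n : ℕ}
    (h : ∀ g' n', 2 * g' + n' < 2 * g + n → ω g' n' = ω' g' n') (i : I) (v : Fin n → I × ℤ) :
    S.bracket ω g n i v = S.bracket ω' g n i v := by
  have hleg (g' m : ℕ) (hm : 2 * g' + m < 2 * g + n) (w) :
      S.leg ω g' m i w = S.leg ω' g' m i w := by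
    match g', m with
    | 0, 0 => rfl
    | 0, 1 => rfl
    | 0, m + 2 => simp only [leg, h _ _ hm]
    | g' + 1, m => simp only [leg, h _ _ hm]
  unfold bracket
  congr 1
  · match g, n with
    | 0, _ => rfl
    | 1, 0 => rfl
    | 1, n + 1 => simp only [loop, h 0 (n + 2) (by omega)]
    | g + 2, n => simp only [loop, h (g + 1) (n + 1) (by omega)]
  · refine Finset.sum_congr rfl fun p hp => Finset.sum_congr rfl fun J _ => ?_
    rw [Finset.HasAntidiagonal.mem_antidiagonal] at hp
    have hJ : J.card + Jᶜ.card = n := by simp [J.card_add_card_compl]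
    generalize hw : v ∘ J.orderEmbOfFin rfl = w
    generalize hw' : v ∘ Jᶜ.orderEmbOfFin rfl = w'
    clear hw hw'
    generalize J.card = a at *
    generalize Jᶜ.card = b at *
    obtain ⟨p, q⟩ := p
    dsimp only at *
    by_cases h1 : 2 * p + a = 0
    · obtain rfl : p = 0 := by omega
      obtain rfl : a = 0 := by omega
      simp [leg]
    by_cases h2 : 2 * q + b = 0
    · obtain rfl : q = 0 := by omega
      obtain rfl : b = 0 := by omega
      have hz : negArg 0 = 0 := by ext; simp [negArg]
      simp [leg, hz]
    rw [hleg p a (by omega), hleg q b (by omega)]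

variable [Fintype I]

/-- The right-hand side of the topological recursion,
`∑ᵢ Res_{ζᵢ → 0} K(ζ₀, ζᵢ) (⋯)`, as an `(n + 1)`-differential in `ζ₀, …, ζₙ`. -/
def step (g n : ℕ) : MultiDiff I (n + 1) where
  coeff v := ∑ i, (S.kernel (v 0) i * S.bracket ω g n i (Fin.tail v)).coeff (-1)
  bdd := by
    have h : Tame (fun v : Fin (n + 1) → I × ℤ =>
        ∑ i, S.kernel (v 0) i * S.bracket ω g n i (Fin.tail v)) :=
      Tame.sum _ fun i => (S.tame_kernel i).mul (S.tame_bracket ω g n i) (fun _ => 0) Fin.succ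
        (Fin.cases (Or.inl ⟨0, rfl⟩) fun j => Or.inr ⟨j, rfl⟩)
    obtain ⟨N, hN⟩ := h.escape 0
    refine ⟨N, fun v hv => ?_⟩
    have := hN v hv (-1) (by norm_num)
    simpa [HahnSeries.coeff_sum] using this

/-- The correlator `ω_{g,n+1}`, for `2g - 2 + (n + 1) > 0`, by recursion on `2g - 2 + (n + 1)`.
(In the unstable cases the value is irrelevant; see `correlator_eq`.) -/
def correlator (g n : ℕ) : MultiDiff I (n + 1) :=
  S.step (fun g' n' => if _h : 2 * g' + n' < 2 * g + n then correlator g' n' else 0) g n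
termination_by 2 * g + n

/-- The topological recursion. -/
theorem correlator_eq (g n : ℕ) : S.correlator g n = S.step S.correlator g n := by
  rw [correlator]
  ext v
  refine Finset.sum_congr rfl fun i _ => ?_
  rw [S.bracket_congr (ω' := S.correlator) (fun g' n' h => by rw [dif_pos h])]

end Curve

/-! ### Equivariant curves -/

/-- A local `G`-equivariant spectral curve with index set `I`. -/
structure EquivariantCurve (G I : Type*) [Group G] [MulAction G I] where
  /-- The action of `G` on `I` is free. -/
  free : ∀ (γ : G) (i : I), γ • i = i → γ = 1
  /-- A system of representatives of the orbits. -/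
  reps : Finset I
  existsUnique_rep : ∀ i : I, ∃! r : I, r ∈ reps ∧ r ∈ MulAction.orbit G i
  χ : G →* ℂˣ
  υ : G →* ℂˣ
  β : G →* ℂˣ
  β_sq : ∀ γ, β γ ^ 2 = 1
  /-- A square root of `χ` (as a function, not necessarily a character). -/
  sqrtχ : G → ℂˣ
  sqrtχ_sq : ∀ γ, sqrtχ γ ^ 2 = χ γ
  sqrtχ_one : sqrtχ 1 = 1
  α : I → ℂ
  h : I → ℕ → ℂ
  jump : I → I → ℕ → ℕ → ℂ
  /-- `y(ζᵢ) - y(-ζᵢ)`, which occurs in the denominator of the recursion kernel, is not zero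
  (this holds in particular when `dy` does not vanish at `ζᵢ = 0`). -/
  y_not_even : ∀ i, ∃ k, Odd k ∧ h i k ≠ 0
  h_smul : ∀ (γ : G), ∀ i ∈ reps, ∀ k : ℕ,
    h (γ • i) k = υ γ * (sqrtχ γ : ℂ) ^ (-(k : ℤ)) * h i k
  jump_symm : ∀ i j k l, jump i j k l = jump j i l k
  jump_smul : ∀ (γ η : G), ∀ i ∈ reps, ∀ j ∈ reps, ∀ k l : ℕ,
    jump (γ • i) (η • j) k l =
      β (γ * η) * (sqrtχ γ : ℂ) ^ (-(k : ℤ) - 1) * (sqrtχ η : ℂ) ^ (-(l : ℤ) - 1) * jump i j k l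

namespace EquivariantCurve

variable {G I : Type*} [Group G] [MulAction G I] (S : EquivariantCurve G I)

theorem exists_decomp (i : I) : ∃ p : G × S.reps, p.1 • (p.2 : I) = i := by
  obtain ⟨r, ⟨hr, γ, rfl⟩, -⟩ := S.existsUnique_rep i
  exact ⟨(γ⁻¹, ⟨_, hr⟩), by simp⟩

/-- The unique `γ` with `i = γ r`, `r` a representative. -/
def grp (i : I) : G := (S.exists_decomp i).choose.1

/-- The unique representative `r` in the orbit of `i`. -/
def rep (i : I) : S.reps := (S.exists_decomp i).choose.2

theorem grp_smul_rep (i : I) : S.grp i • (S.rep i : I) = i := (S.exists_decomp i).choose_spec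

/-- The extension of a multidifferential on the quotient curve to all components by
`ω(…, ζ_{γ r}, …) = β_γ ω(…, ζ_r, …)` in each variable, for `r` a representative and
`ζ_{γ r} = √χ_γ ζ_r`. -/
def extend {n : ℕ} (ω : MultiDiff S.reps n) : MultiDiff I n where
  coeff v := (∏ j, (S.β (S.grp (v j).1) : ℂ) * (S.sqrtχ (S.grp (v j).1) : ℂ) ^ (-(v j).2 - 1)) *
    ω.coeff fun j => (S.rep (v j).1, (v j).2)
  bdd := by
    obtain ⟨N, hN⟩ := ω.bdd
    exact ⟨N, fun v hv => by rw [hN _ hv, mul_zero]⟩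

variable [Fintype G]

open Classical in
/-- The biresidues `(∑_γ β_γ δ_{i,γj}) / |G|` of `B`. -/
def biresidue (i j : I) : ℂ :=
  (∑ γ : G, if i = γ • j then (S.β γ : ℂ) else 0) / Fintype.card G

theorem biresidue_symm (i j : I) : S.biresidue i j = S.biresidue j i := by
  unfold biresidue
  congr 1
  refine Fintype.sum_equiv (Equiv.inv G) _ _ fun γ => ?_
  have h1 : S.β γ⁻¹ = S.β γ := by
    rw [map_inv, inv_eq_iff_mul_eq_one, ← sq, S.β_sq]
  have h2 : i = γ • j ↔ j = γ⁻¹ • i := by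
    rw [eq_inv_smul_iff, eq_comm]
  rw [Equiv.inv_apply, h1]
  by_cases h : i = γ • j
  · rw [if_pos h, if_pos (h2.1 h)]
  · rw [if_neg h, if_neg (mt h2.2 h)]

/-- The underlying curve.  For `i = γ r` with `r` a representative, `ζᵢ / √χ_γ` corresponds to `ζᵣ`
under the action of `γ`, so that the poles of a `B` which is equivariant are along
`ζᵢ / √χ_γ = ζⱼ / √χ_η`, for `i = γ r` and `j = η r`. -/
def toCurve : Curve I where
  α := S.α
  h := S.h
  τ i := S.sqrtχ (S.grp i)
  c := S.biresidue
  jump := S.jump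
  c_symm := S.biresidue_symm
  jump_symm := S.jump_symm

/-- The quotient (or reduced) curve: the restriction of `x`, `y` and `B` to the components whose
index is a representative. -/
def reduced : Curve S.reps := S.toCurve.comap Subtype.val

end EquivariantCurve

end

end LocalTR

/-!
The quotient map from an equivariant curve to its reduced curve is a change of coordinates
`ζ_{f(i)} = uᵢ ζᵢ` on each component, under which `B` and `y` are pulled back up to constants.
Pulling back a differential along `ζ ↦ u ζ` is multiplicative and preserves residues, so each
ingredient of the recursion on `S` at the component `i` is a multiple of the pullback of the same
ingredient on the quotient at `f(i)`.  The signs of the two legs at `ζᵢ` and `-ζᵢ` cancel, and what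
remains of the constants is the factor `β_γ / (χ_γ υ_γ)` at `i = γ r`.  Hence each application of
the recursion contributes one factor `∑_γ β_γ / (χ_γ υ_γ)`, which is `|G|` or `0` by orthogonality
of characters.
-/

namespace LocalTR

noncomputable section

section Dilation

variable {R : Type*} [CommSemiring R]

/-- The pullback of the formal differential `f(ζ) (dζ)^d` along `ζ ↦ u ζ`, written again as a
Laurent series times `(dζ)^d`. -/
def dilate (d : ℤ) (u : Rˣ) : LaurentSeries R →ₗ[R] LaurentSeries R where
  toFun f :=
    { coeff := fun p => ((u ^ (p + d) : Rˣ) : R) * f.coeff p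
      isPWO_support' := f.isPWO_support.mono fun p hp h => hp (by simp [h]) }
  map_add' f g := by ext p; simp [mul_add]
  map_smul' a f := by ext p; simp [mul_left_comm]

@[simp]
theorem coeff_dilate (d : ℤ) (u : Rˣ) (f : LaurentSeries R) (p : ℤ) :
    (dilate d u f).coeff p = ((u ^ (p + d) : Rˣ) : R) * f.coeff p := rfl

theorem dilate_injective (d : ℤ) (u : Rˣ) : Function.Injective (dilate d u) := fun f g h => by
  ext p
  simpa using congrArg (HahnSeries.coeff · p) h

theorem dilate_comm (d e : ℤ) (u w : Rˣ) (f : LaurentSeries R) :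
    dilate d u (dilate e w f) = dilate e w (dilate d u f) := by
  ext p
  simp only [coeff_dilate, mul_left_comm]

theorem dilate_mul_dilate (d e : ℤ) (u : Rˣ) (f g : LaurentSeries R) :
    dilate d u f * dilate e u g = dilate (d + e) u (f * g) := by
  ext p
  simp only [coeff_dilate, HahnSeries.coeff_mul, Finset.mul_sum]
  refine Finset.sum_congr ?_ fun x hx => ?_
  · ext x
    simp [Finset.mem_antidiagonal, HahnSeries.mem_support]
  · have hx : x.1 + x.2 = p := (Finset.mem_antidiagonal.1 hx).2.2
    have hexp : x.1 + x.2 + (d + e) = (x.1 + d) + (x.2 + e) := by ring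
    rw [← hx, hexp, mul_mul_mul_comm, ← Units.val_mul, ← zpow_add]

theorem smul_dilate_mul_smul_dilate (a b : R) (d e : ℤ) (u : Rˣ) (f g : LaurentSeries R) :
    (a • dilate d u f) * (b • dilate e u g) = (a * b) • dilate (d + e) u (f * g) := by
  rw [← dilate_mul_dilate]
  simp only [← HahnSeries.C_mul_eq_smul, map_mul, mul_mul_mul_comm]

theorem coeff_neg_one_dilate_one (u : Rˣ) (f : LaurentSeries R) :
    (dilate 1 u f).coeff (-1) = f.coeff (-1) := by
  simp

theorem ofPowerSeries_eq_smul_dilate {f g : PowerSeries R} {a : R} {d : ℕ} {u : Rˣ}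
    (h : ∀ k, PowerSeries.coeff k f = a * ((u : R) ^ (k + d) * PowerSeries.coeff k g)) :
    HahnSeries.ofPowerSeries ℤ R f = a • dilate d u (HahnSeries.ofPowerSeries ℤ R g) := by
  ext p
  rw [HahnSeries.coeff_smul, coeff_dilate, smul_eq_mul]
  obtain hp | hp := lt_or_ge p 0
  · have hz (q : PowerSeries R) : (HahnSeries.ofPowerSeries ℤ R q).coeff p = 0 := by
      rw [HahnSeries.ofPowerSeries_apply]
      refine HahnSeries.embDomain_of_notMem_range ?_
      rintro ⟨k, rfl⟩
      exact hp.not_ge k.cast_nonneg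
    rw [hz, hz, mul_zero, mul_zero]
  · lift p to ℕ using hp
    rw [HahnSeries.ofPowerSeries_apply_coeff, HahnSeries.ofPowerSeries_apply_coeff, h,
      ← Nat.cast_add, zpow_natCast, Units.val_pow_eq_pow_val]

theorem smul_dilate_div_smul_dilate {K : Type*} [Field K] (a b : K) (d e : ℤ) (u : Kˣ)
    (f g : LaurentSeries K) :
    (a • dilate d u f) / (b • dilate e u g) = (a / b) • dilate (d - e) u (f / g) := by
  have hdiv : dilate d u f / dilate e u g = dilate (d - e) u (f / g) := by
    obtain rfl | hg := eq_or_ne g 0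
    · simp
    · have hdg : dilate e u g ≠ 0 := (map_ne_zero_iff _ (dilate_injective e u)).2 hg
      rw [div_eq_iff hdg, dilate_mul_dilate, sub_add_cancel, div_mul_cancel₀ _ hg]
  rw [← hdiv]
  simp only [← HahnSeries.C_mul_eq_smul, map_div₀ HahnSeries.C, mul_div_mul_comm]

end Dilation

theorem neg_negArg (f : LaurentSeries ℂ) : -negArg f = dilate 1 (-1) f := by
  ext p
  simp [negArg, zpow_add_one]

theorem coeff_symIntegral_zero (f : PowerSeries ℂ) :
    PowerSeries.coeff 0 (symIntegral f) = 0 := by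
  simp only [symIntegral, map_sub, PowerSeries.coeff_rescale, PowerSeries.coeff_mk, if_true,
    mul_zero, sub_zero]

theorem coeff_symIntegral_succ (f : PowerSeries ℂ) (k : ℕ) :
    PowerSeries.coeff (k + 1) (symIntegral f) =
      (1 - (-1) ^ (k + 1)) / (k + 1) * PowerSeries.coeff k f := by
  simp only [symIntegral, map_sub, PowerSeries.coeff_rescale, PowerSeries.coeff_mk,
    Nat.add_one_ne_zero, if_false, Nat.add_sub_cancel, Nat.cast_add_one]
  ring

namespace MultiDiff

variable {I : Type*} {n : ℕ}

instance : SMul ℂ (MultiDiff I n) where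
  smul a ω :=
    { coeff := fun v => a * ω.coeff v
      bdd := ω.bdd.imp fun _ hN v hv => by rw [hN v hv, mul_zero] }

@[simp]
theorem coeff_smul (a : ℂ) (ω : MultiDiff I n) (v : Fin n → I × ℤ) :
    (a • ω).coeff v = a * ω.coeff v := rfl

theorem zero_smul (ω : MultiDiff I n) : (0 : ℂ) • ω = 0 := by
  ext v
  exact zero_mul _

theorem coeff_series (ω : MultiDiff I (n + 1)) (i : I) (v : Fin n → I × ℤ) (p : ℤ) :
    (ω.series i v).coeff p = ω.coeff (Fin.cons (i, p) v) := rfl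

theorem coeff_diag (ω : MultiDiff I (n + 2)) (i : I) (v : Fin n → I × ℤ) (m : ℤ) :
    (ω.diag i v).coeff m = ∑ᶠ p : ℤ, (-1) ^ (m - p + 1) *
      ω.coeff (Fin.cons (i, p) (Fin.cons (i, m - p) v : Fin (n + 1) → I × ℤ)) := rfl

theorem series_smul (a : ℂ) (ω : MultiDiff I (n + 1)) (i : I) (v : Fin n → I × ℤ) :
    (a • ω).series i v = a • ω.series i v := rfl

theorem diag_smul (a : ℂ) (ω : MultiDiff I (n + 2)) (i : I) (v : Fin n → I × ℤ) :
    (a • ω).diag i v = a • ω.diag i v := by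
  ext m
  rw [HahnSeries.coeff_smul, coeff_diag, coeff_diag, smul_finsum]
  exact finsum_congr fun p => mul_left_comm ..

end MultiDiff

namespace Curve

variable {I J : Type*} {S : Curve I} {T : Curve J}

theorem coeff_derivative_x (S : Curve I) (i : I) (k : ℕ) :
    PowerSeries.coeff k (PowerSeries.derivative ℂ (S.x i)) = if k = 1 then 2 else 0 := by
  rw [PowerSeries.coeff_derivative, x, map_add, PowerSeries.coeff_X_pow, PowerSeries.coeff_C]
  by_cases hk : k = 1 <;> simp [hk, one_add_one_eq_two]

theorem coeff_y_sub_rescale (S : Curve I) (i : I) (k : ℕ) :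
    PowerSeries.coeff k (S.y i - PowerSeries.rescale (-1) (S.y i)) =
      (1 - (-1) ^ k) * S.h i k := by
  rw [map_sub, PowerSeries.coeff_rescale, y, PowerSeries.coeff_mk, sub_mul, one_mul]

/-- A map from the curve `S` to the curve `T` which sends the component `i` to the component
`index i` by `ζ_{index i} = scale i * ζᵢ`, and pulls `B` back up to signs and `y` up to constants:
`B(ζᵢ, ζⱼ)` is the pullback of `B` on `T` times `sign i * sign j`, and `y(ζᵢ)` is the pullback of
`y` on `T` times `yScale i`.  Since `t = ζ / τ`, the condition on `τ` says that the parameters `t`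
correspond to each other. -/
structure TwistedMap (S : Curve I) (T : Curve J) where
  index : I → J
  scale : I → ℂˣ
  sign : I → ℂ
  yScale : I → ℂˣ
  sign_mul_self : ∀ i, sign i * sign i = 1
  h_eq : ∀ i k, S.h i k = yScale i * ((scale i : ℂ) ^ k * T.h (index i) k)
  τ_index : ∀ i, T.τ (index i) = scale i * S.τ i
  c_eq : ∀ i j, S.c i j = sign i * sign j * T.c (index i) (index j)
  jump_eq : ∀ i j k l, S.jump i j k l =
    sign i * (scale i : ℂ) ^ (k + 1) * (sign j * (scale j : ℂ) ^ (l + 1)) *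
      T.jump (index i) (index j) k l

namespace TwistedMap

variable (π : TwistedMap S T) {n : ℕ}

/-- The label of `ζ_{index i}^m` on `T`, for the label `(i, m)` of the monomial `ζᵢ^m` on `S`. -/
def label (e : I × ℤ) : J × ℤ := (π.index e.1, e.2)

/-- The coefficient of `ζᵢ^m dζᵢ` in the pullback of `ζ^m dζ` times `sign i`, for `e = (i, m)`. -/
def weight (e : I × ℤ) : ℂ := π.sign e.1 * ((π.scale e.1 ^ (e.2 + 1) : ℂˣ) : ℂ)

/-- The product of the weights of all variables of a monomial. -/
def totalWeight (v : Fin n → I × ℤ) : ℂ := ∏ j, π.weight (v j)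

/-- The pullback of a multidifferential, with the sign of the component in each variable. -/
def pullback (ω : MultiDiff J n) : MultiDiff I n where
  coeff v := π.totalWeight v * ω.coeff (π.label ∘ v)
  bdd := ω.bdd.imp fun _ hN v hv => by rw [hN (π.label ∘ v) hv, mul_zero]

/-- The factor by which the residues at `ζᵢ → 0` in the recursion on `S` differ from the residue at
`ζ_{index i} → 0` in the recursion on `T`. -/
def multiplicity (i : I) : ℂ := π.sign i * (π.scale i : ℂ) ^ 2 / π.yScale i

theorem coeff_pullback (ω : MultiDiff J n) (v : Fin n → I × ℤ) :
    (π.pullback ω).coeff v = π.totalWeight v * ω.coeff (π.label ∘ v) := rfl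

theorem totalWeight_cons (e : I × ℤ) (v : Fin n → I × ℤ) :
    π.totalWeight (Fin.cons e v : Fin (n + 1) → I × ℤ) = π.weight e * π.totalWeight v := by
  simp [totalWeight, Fin.prod_univ_succ]

theorem totalWeight_eq_mul_tail (v : Fin (n + 1) → I × ℤ) :
    π.totalWeight v = π.weight (v 0) * π.totalWeight (Fin.tail v) :=
  Fin.prod_univ_succ _

theorem totalWeight_mul_compl (K : Finset (Fin n)) (v : Fin n → I × ℤ) :
    π.totalWeight (v ∘ K.orderEmbOfFin rfl) * π.totalWeight (v ∘ Kᶜ.orderEmbOfFin rfl) =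
      π.totalWeight v := by
  simp only [totalWeight, ← (finSumEquivOfFinset (s := K) rfl rfl).prod_comp,
    Fintype.prod_sum_type, finSumEquivOfFinset_inl, finSumEquivOfFinset_inr, Function.comp_apply]

theorem label_comp_cons (e : I × ℤ) (v : Fin n → I × ℤ) :
    π.label ∘ (Fin.cons e v : Fin (n + 1) → I × ℤ) = Fin.cons (π.label e) (π.label ∘ v) :=
  Fin.comp_cons ..

theorem series_pullback (ω : MultiDiff J (n + 1)) (i : I) (v : Fin n → I × ℤ) :
    (π.pullback ω).series i v = (π.totalWeight v * π.sign i) •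
      dilate 1 (π.scale i) (ω.series (π.index i) (π.label ∘ v)) := by
  ext p
  simp only [MultiDiff.coeff_series, coeff_pullback, totalWeight_cons, label_comp_cons, weight,
    label, HahnSeries.coeff_smul, coeff_dilate, smul_eq_mul]
  ring

theorem diag_pullback (ω : MultiDiff J (n + 2)) (i : I) (v : Fin n → I × ℤ) :
    (π.pullback ω).diag i v = π.totalWeight v •
      dilate 2 (π.scale i) (ω.diag (π.index i) (π.label ∘ v)) := by
  ext m
  rw [HahnSeries.coeff_smul, coeff_dilate, smul_eq_mul, ← mul_assoc]
  simp only [MultiDiff.coeff_diag, ← smul_eq_mul (_ * _) (∑ᶠ _, _), smul_finsum]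
  refine finsum_congr fun p => ?_
  have hweight : π.weight (i, p) * π.weight (i, m - p) =
      ((π.scale i ^ (m + 2) : ℂˣ) : ℂ) := by
    rw [weight, weight, mul_mul_mul_comm, sign_mul_self, one_mul, ← Units.val_mul, ← zpow_add]
    ring_nf
  rw [coeff_pullback, totalWeight_cons, totalWeight_cons, label_comp_cons, label_comp_cons,
    ← hweight, smul_eq_mul, label, label]
  ring

theorem coeff_bSeries (e : I × ℤ) (i : I) (k : ℕ) :
    PowerSeries.coeff k (S.bSeries e i) = π.weight e * π.sign i *
      ((π.scale i : ℂ) ^ (k + 1) * PowerSeries.coeff k (T.bSeries (π.label e) (π.index i))) := by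
  obtain ⟨a, m⟩ := e
  change PowerSeries.coeff k (S.bSeries (a, m) i) = π.weight (a, m) * π.sign i *
    ((π.scale i : ℂ) ^ (k + 1) * PowerSeries.coeff k (T.bSeries (π.index a, m) (π.index i)))
  simp only [bSeries, PowerSeries.coeff_mk, weight]
  rw [mul_add (_ ^ _) (ite _ _ _), mul_add (_ * _) (_ * ite _ _ _)]
  congr 1
  · split_ifs with hm
    · have hexp : m + 1 = -((k + 1 : ℕ) : ℤ) := by rw [hm]; push_cast; ring
      rw [π.c_eq, π.τ_index, π.τ_index, hexp, zpow_neg, zpow_natCast]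
      simp only [Units.val_mul, Units.val_inv_eq_inv_val, Units.val_pow_eq_pow_val, div_pow,
        mul_pow]
      field_simp
    · simp only [mul_zero]
  · split_ifs with hm
    · lift m to ℕ using hm
      rw [π.jump_eq, Int.toNat_natCast, ← Nat.cast_add_one, zpow_natCast,
        Units.val_pow_eq_pow_val]
      ring
    · simp only [mul_zero]

theorem ofPowerSeries_bSeries (e : I × ℤ) (i : I) :
    HahnSeries.ofPowerSeries ℤ ℂ (S.bSeries e i) = (π.weight e * π.sign i) •
      dilate 1 (π.scale i)
        (HahnSeries.ofPowerSeries ℤ ℂ (T.bSeries (π.label e) (π.index i))) :=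
  ofPowerSeries_eq_smul_dilate (d := 1) (π.coeff_bSeries e i)

theorem ofPowerSeries_symIntegral_bSeries (e : I × ℤ) (i : I) :
    HahnSeries.ofPowerSeries ℤ ℂ (PowerSeries.C (1 / 2) * symIntegral (S.bSeries e i)) =
      (π.weight e * π.sign i) • dilate 0 (π.scale i) (HahnSeries.ofPowerSeries ℤ ℂ
        (PowerSeries.C (1 / 2) * symIntegral (T.bSeries (π.label e) (π.index i)))) := by
  refine ofPowerSeries_eq_smul_dilate (d := 0) fun k => ?_
  rw [PowerSeries.coeff_C_mul, PowerSeries.coeff_C_mul]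
  cases k with
  | zero => simp only [coeff_symIntegral_zero, mul_zero]
  | succ k =>
    rw [coeff_symIntegral_succ, coeff_symIntegral_succ, π.coeff_bSeries e i]
    ring

theorem ofPowerSeries_y_sub_rescale (i : I) :
    HahnSeries.ofPowerSeries ℤ ℂ (S.y i - PowerSeries.rescale (-1) (S.y i)) =
      (π.yScale i : ℂ) • dilate 0 (π.scale i) (HahnSeries.ofPowerSeries ℤ ℂ
        (T.y (π.index i) - PowerSeries.rescale (-1) (T.y (π.index i)))) := by
  refine ofPowerSeries_eq_smul_dilate (d := 0) fun k => ?_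
  rw [coeff_y_sub_rescale, coeff_y_sub_rescale, π.h_eq]
  ring

theorem ofPowerSeries_derivative_x (i : I) :
    HahnSeries.ofPowerSeries ℤ ℂ (PowerSeries.derivative ℂ (S.x i)) =
      ((π.scale i : ℂ) ^ 2)⁻¹ • dilate 1 (π.scale i) (HahnSeries.ofPowerSeries ℤ ℂ
        (PowerSeries.derivative ℂ (T.x (π.index i)))) := by
  refine ofPowerSeries_eq_smul_dilate (d := 1) fun k => ?_
  rw [coeff_derivative_x, coeff_derivative_x]
  split_ifs with hk
  · subst hk
    field_simp
  · simp only [mul_zero]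

theorem kernel_eq (e : I × ℤ) (i : I) :
    S.kernel e i = (π.weight e * π.multiplicity i) •
      dilate (-1) (π.scale i) (T.kernel (π.label e) (π.index i)) := by
  simp only [kernel, map_mul (HahnSeries.ofPowerSeries ℤ ℂ) (_ - _)]
  rw [π.ofPowerSeries_symIntegral_bSeries, π.ofPowerSeries_y_sub_rescale,
    π.ofPowerSeries_derivative_x, smul_dilate_mul_smul_dilate,
    smul_dilate_div_smul_dilate]
  congr 1
  rw [multiplicity]
  field_simp

theorem bDiag_eq (i : I) :
    S.bDiag i = dilate 2 (π.scale i) (T.bDiag (π.index i)) := by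
  rw [bDiag, bDiag, map_add]
  congr 1
  · ext p
    rw [coeff_dilate, π.c_eq, sign_mul_self, one_mul]
    obtain rfl | hp := eq_or_ne p (-2)
    · simp
    · simp [HahnSeries.coeff_single_of_ne hp]
  · rw [← one_smul ℂ (dilate _ _ _)]
    refine ofPowerSeries_eq_smul_dilate (d := 2) fun k => ?_
    rw [PowerSeries.coeff_mk, PowerSeries.coeff_mk, one_mul, Finset.mul_sum]
    refine Finset.sum_congr rfl fun p hp => ?_
    rw [π.jump_eq, mul_mul_mul_comm, sign_mul_self,
      ← Finset.HasAntidiagonal.mem_antidiagonal.1 hp]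
    ring

section Recursion

variable {π} {c : ℂ} {ω : ∀ (_ n : ℕ), MultiDiff I (n + 1)} {ω' : ∀ (_ n : ℕ), MultiDiff J (n + 1)}

theorem leg_eq {g : ℕ}
    (hω : 2 ≤ 2 * g + n → ω g n = c ^ (2 * g + n - 1) • π.pullback (ω' g n))
    (i : I) (v : Fin n → I × ℤ) :
    S.leg ω g n i v = (c ^ (2 * g + n - 1) * π.totalWeight v * π.sign i) •
      dilate 1 (π.scale i) (T.leg ω' g n (π.index i) (π.label ∘ v)) := by
  have hseries {g n : ℕ} (h : ω g n = c ^ (2 * g + n - 1) • π.pullback (ω' g n))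
      (v : Fin n → I × ℤ) : (ω g n).series i v =
        (c ^ (2 * g + n - 1) * π.totalWeight v * π.sign i) •
          dilate 1 (π.scale i) ((ω' g n).series (π.index i) (π.label ∘ v)) := by
    rw [h, MultiDiff.series_smul, π.series_pullback, smul_smul, mul_assoc]
  match g, n with
  | 0, 0 => simp [leg]
  | 0, 1 => simp [leg, π.ofPowerSeries_bSeries, totalWeight]
  | 0, n + 2 => exact hseries (hω (by omega)) v
  | g + 1, n => exact hseries (hω (by omega)) v

theorem loop_eq {g : ℕ}
    (hω : ∀ g' n', 2 ≤ 2 * g' + n' → 2 * g' + n' < 2 * g + n →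
      ω g' n' = c ^ (2 * g' + n' - 1) • π.pullback (ω' g' n'))
    (i : I) (v : Fin n → I × ℤ) :
    S.loop ω g n i v = (c ^ (2 * g + n - 2) * π.totalWeight v) •
      dilate 2 (π.scale i) (T.loop ω' g n (π.index i) (π.label ∘ v)) := by
  have hdiag {g n : ℕ} (h : ω g (n + 1) = c ^ (2 * g + n) • π.pullback (ω' g (n + 1)))
      (v : Fin n → I × ℤ) : (ω g (n + 1)).diag i v = (c ^ (2 * g + n) * π.totalWeight v) •
        dilate 2 (π.scale i) ((ω' g (n + 1)).diag (π.index i) (π.label ∘ v)) := by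
    rw [h, MultiDiff.diag_smul, π.diag_pullback, smul_smul]
  match g, n with
  | 0, _ => simp [loop]
  | 1, 0 => simp [loop, π.bDiag_eq, totalWeight]
  | 1, n + 1 =>
    rw [show 2 * 1 + (n + 1) - 2 = 2 * 0 + (n + 1) by omega]
    exact hdiag (hω 0 (n + 2) (by omega) (by omega)) v
  | g + 2, n =>
    rw [show 2 * (g + 2) + n - 2 = 2 * (g + 1) + n by omega]
    exact hdiag (hω (g + 1) (n + 1) (by omega) (by omega)) v

theorem leg_mul_neg_negArg_leg {p q a b : ℕ}
    (hω : ∀ g n, 2 ≤ 2 * g + n → 2 * g + n < (2 * p + a) + (2 * q + b) →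
      ω g n = c ^ (2 * g + n - 1) • π.pullback (ω' g n))
    (i : I) (v : Fin a → I × ℤ) (w : Fin b → I × ℤ) :
    S.leg ω p a i v * -negArg (S.leg ω q b i w) =
      (c ^ ((2 * p + a) + (2 * q + b) - 2) * (π.totalWeight v * π.totalWeight w)) •
        dilate 2 (π.scale i) (T.leg ω' p a (π.index i) (π.label ∘ v) *
          -negArg (T.leg ω' q b (π.index i) (π.label ∘ w))) := by
  simp only [neg_negArg]
  obtain hp | hp := Nat.eq_zero_or_pos (2 * p + a)
  · obtain ⟨rfl, rfl⟩ : p = 0 ∧ a = 0 := by omega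
    simp [leg]
  obtain hq | hq := Nat.eq_zero_or_pos (2 * q + b)
  · obtain ⟨rfl, rfl⟩ : q = 0 ∧ b = 0 := by omega
    simp [leg]
  have hexp : (2 * p + a) + (2 * q + b) - 2 = (2 * p + a - 1) + (2 * q + b - 1) := by omega
  rw [leg_eq fun h => hω p a h (by omega), leg_eq fun h => hω q b h (by omega), map_smul,
    dilate_comm, smul_dilate_mul_smul_dilate, one_add_one_eq_two, hexp, pow_add]
  congr 1
  linear_combination c ^ (2 * p + a - 1) * c ^ (2 * q + b - 1) * π.totalWeight v *
    π.totalWeight w * π.sign_mul_self i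

theorem bracket_eq {g : ℕ}
    (hω : ∀ g' n', 2 ≤ 2 * g' + n' → 2 * g' + n' < 2 * g + n →
      ω g' n' = c ^ (2 * g' + n' - 1) • π.pullback (ω' g' n'))
    (i : I) (v : Fin n → I × ℤ) :
    S.bracket ω g n i v = (c ^ (2 * g + n - 2) * π.totalWeight v) •
      dilate 2 (π.scale i) (T.bracket ω' g n (π.index i) (π.label ∘ v)) := by
  simp only [bracket, map_add, smul_add, map_sum, Finset.smul_sum]
  congr 1
  · exact loop_eq hω i v
  refine Finset.sum_congr rfl fun p hp => Finset.sum_congr rfl fun K _ => ?_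
  have hdeg : (2 * p.1 + K.card) + (2 * p.2 + Kᶜ.card) = 2 * g + n := by
    have hg := Finset.HasAntidiagonal.mem_antidiagonal.1 hp
    have hn : K.card + Kᶜ.card = n := by rw [K.card_add_card_compl, Fintype.card_fin]
    omega
  rw [leg_mul_neg_negArg_leg (hdeg ▸ hω), hdeg, totalWeight_mul_compl, Function.comp_assoc,
    Function.comp_assoc]

theorem residue_eq {g : ℕ}
    (hω : ∀ g' n', 2 ≤ 2 * g' + n' → 2 * g' + n' < 2 * g + n →
      ω g' n' = c ^ (2 * g' + n' - 1) • π.pullback (ω' g' n'))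
    (i : I) (e : I × ℤ) (v : Fin n → I × ℤ) :
    (S.kernel e i * S.bracket ω g n i v).coeff (-1) =
      c ^ (2 * g + n - 2) * (π.weight e * π.totalWeight v) * (π.multiplicity i *
        (T.kernel (π.label e) (π.index i) *
          T.bracket ω' g n (π.index i) (π.label ∘ v)).coeff (-1)) := by
  rw [π.kernel_eq, bracket_eq hω, smul_dilate_mul_smul_dilate,
    show (-1 + 2 : ℤ) = 1 by norm_num, HahnSeries.coeff_smul, coeff_neg_one_dilate_one,
    smul_eq_mul]
  ring

variable [Fintype I] [Fintype J] [DecidableEq J]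

theorem step_eq (hc : ∀ j, ∑ i with π.index i = j, π.multiplicity i = c) {g : ℕ}
    (hgn : 2 ≤ 2 * g + n)
    (hω : ∀ g' n', 2 ≤ 2 * g' + n' → 2 * g' + n' < 2 * g + n →
      ω g' n' = c ^ (2 * g' + n' - 1) • π.pullback (ω' g' n')) :
    S.step ω g n = c ^ (2 * g + n - 1) • π.pullback (T.step ω' g n) := by
  ext v
  let res (j : J) : ℂ := (T.kernel (π.label (v 0)) j *
    T.bracket ω' g n j (π.label ∘ Fin.tail v)).coeff (-1)
  have hfiber (j : J) : ∑ i with π.index i = j, π.multiplicity i * res (π.index i) = c * res j := by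
    rw [← hc j, Finset.sum_mul]
    refine Finset.sum_congr rfl fun i hi => ?_
    rw [(Finset.mem_filter.1 hi).2]
  calc ∑ i, (S.kernel (v 0) i * S.bracket ω g n i (Fin.tail v)).coeff (-1)
    _ = ∑ i, c ^ (2 * g + n - 2) * π.totalWeight v * (π.multiplicity i * res (π.index i)) := by
      simp only [residue_eq hω, totalWeight_eq_mul_tail, res]
    _ = c ^ (2 * g + n - 2) * π.totalWeight v * ∑ j, c * res j := by
      rw [← Finset.mul_sum, ← Finset.sum_fiberwise _ π.index, Finset.sum_congr rfl fun j _ =>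
        hfiber j]
    _ = c ^ (2 * g + n - 2 + 1) * (π.totalWeight v * ∑ j, res j) := by
      rw [← Finset.mul_sum, pow_succ]
      ring
    _ = c ^ (2 * g + n - 1) * (π.totalWeight v * ∑ j, res j) := by
      rw [show 2 * g + n - 2 + 1 = 2 * g + n - 1 by omega]

theorem correlator_eq (hc : ∀ j, ∑ i with π.index i = j, π.multiplicity i = c) (g n : ℕ)
    (hgn : 2 ≤ 2 * g + n) :
    S.correlator g n = c ^ (2 * g + n - 1) • π.pullback (T.correlator g n) := by
  rw [S.correlator_eq, T.correlator_eq]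
  exact step_eq hc hgn fun g' n' hgn' _ => correlator_eq hc g' n' hgn'
termination_by 2 * g + n

end Recursion

end TwistedMap

end Curve

namespace EquivariantCurve

variable {G I : Type*} [Group G] [MulAction G I] (S : EquivariantCurve G I)

theorem rep_smul (γ : G) (r : S.reps) : S.rep (γ • (r : I)) = r := by
  refine Subtype.ext <| (S.existsUnique_rep (γ • (r : I))).unique ⟨(S.rep _).2, ?_⟩ ⟨r.2, ?_⟩
  · exact ⟨(S.grp (γ • (r : I)))⁻¹, inv_smul_eq_iff.2 (S.grp_smul_rep _).symm⟩
  · exact ⟨γ⁻¹, inv_smul_smul γ _⟩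

theorem grp_smul (γ : G) (r : S.reps) : S.grp (γ • (r : I)) = γ := by
  have h : S.grp (γ • (r : I)) • (r : I) = γ • (r : I) := by
    simpa only [rep_smul] using S.grp_smul_rep (γ • (r : I))
  exact (inv_mul_eq_one.1 (S.free _ r (by rw [mul_smul, h, inv_smul_smul]))).symm

theorem grp_rep (r : S.reps) : S.grp (r : I) = 1 := by
  simpa only [one_smul] using S.grp_smul 1 r

theorem β_inv (γ : G) : S.β γ⁻¹ = S.β γ := by
  rw [map_inv, inv_eq_iff_mul_eq_one, ← sq, S.β_sq]

theorem h_eq (i : I) (k : ℕ) :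
    S.h i k = S.υ (S.grp i) * ((((S.sqrtχ (S.grp i))⁻¹ : ℂˣ) : ℂ) ^ k * S.h (S.rep i) k) := by
  conv_lhs => rw [← S.grp_smul_rep i]
  rw [S.h_smul _ _ (S.rep i).2 k, zpow_neg, zpow_natCast, Units.val_inv_eq_inv_val, inv_pow,
    mul_assoc]

theorem jump_eq (i j : I) (k l : ℕ) :
    S.jump i j k l =
      S.β (S.grp i) * (((S.sqrtχ (S.grp i))⁻¹ : ℂˣ) : ℂ) ^ (k + 1) *
        (S.β (S.grp j) * (((S.sqrtχ (S.grp j))⁻¹ : ℂˣ) : ℂ) ^ (l + 1)) *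
        S.jump (S.rep i) (S.rep j) k l := by
  have hexp (m : ℕ) : -(m : ℤ) - 1 = -((m + 1 : ℕ) : ℤ) := by push_cast; ring
  conv_lhs => rw [← S.grp_smul_rep i, ← S.grp_smul_rep j]
  rw [S.jump_smul _ _ _ (S.rep i).2 _ (S.rep j).2 k l, map_mul, Units.val_mul, hexp, hexp,
    zpow_neg, zpow_neg, zpow_natCast, zpow_natCast]
  simp only [Units.val_inv_eq_inv_val, inv_pow]
  ring

variable [Fintype G]

theorem biresidue_eq (i j : I) :
    S.biresidue i j =
      S.β (S.grp i) * S.β (S.grp j) * S.biresidue (S.rep i) (S.rep j) := by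
  classical
  unfold biresidue
  rw [mul_div_assoc', Finset.mul_sum]
  congr 1
  refine (Fintype.sum_equiv ((Equiv.mulLeft (S.grp i)).trans (Equiv.mulRight (S.grp j)⁻¹)) _ _
    fun γ => ?_).symm
  have hrep (i : I) : (S.grp i)⁻¹ • i = S.rep i := inv_smul_eq_iff.2 (S.grp_smul_rep i).symm
  have hiff : i = (S.grp i * γ * (S.grp j)⁻¹) • j ↔ (S.rep i : I) = γ • (S.rep j : I) := by
    rw [mul_smul, mul_smul, ← inv_smul_eq_iff, hrep, hrep]
  simp only [Equiv.trans_apply, Equiv.coe_mulLeft, Equiv.coe_mulRight, mul_ite, mul_zero, map_mul,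
    β_inv, Units.val_mul, mul_right_comm]
  exact if_congr hiff.symm rfl rfl

/-- The quotient map of an equivariant curve: `i = γ r` is sent to the representative `r`, with
`ζᵣ = ζᵢ / √χ_γ`. -/
def quotient : S.toCurve.TwistedMap S.reduced where
  index := S.rep
  scale i := (S.sqrtχ (S.grp i))⁻¹
  sign i := S.β (S.grp i)
  yScale i := S.υ (S.grp i)
  sign_mul_self i := by rw [← Units.val_mul, ← sq, S.β_sq, Units.val_one]
  h_eq := S.h_eq
  τ_index i := by
    change S.sqrtχ (S.grp (S.rep i : I)) = (S.sqrtχ (S.grp i))⁻¹ * S.sqrtχ (S.grp i)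
    rw [grp_rep, sqrtχ_one, inv_mul_cancel]
  c_eq := S.biresidue_eq
  jump_eq := S.jump_eq

theorem pullback_quotient {n : ℕ} (ω : MultiDiff S.reps n) :
    S.quotient.pullback ω = S.extend ω := by
  ext v
  change (∏ j, _ * (((S.sqrtχ (S.grp (v j).1))⁻¹ ^ ((v j).2 + 1) : ℂˣ) : ℂ)) * _ = _
  simp only [inv_zpow', neg_add', Units.val_zpow_eq_zpow_val]
  rfl

theorem multiplicity_quotient (i : I) :
    S.quotient.multiplicity i = (S.β / (S.χ * S.υ)) (S.grp i) := by
  change (S.β (S.grp i) : ℂ) * (((S.sqrtχ (S.grp i))⁻¹ : ℂˣ) : ℂ) ^ 2 / S.υ (S.grp i) = _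
  simp only [MonoidHom.div_apply, MonoidHom.mul_apply, ← S.sqrtχ_sq, Units.val_div_eq_div_val,
    Units.val_mul, Units.val_pow_eq_pow_val, Units.val_inv_eq_inv_val]
  field_simp

/-- The sum over the group of the character `β / (χ υ)`, which is the number of times the residue
at a representative is counted in the recursion on the equivariant curve. -/
def charSum : ℂ := ∑ γ : G, ((S.β / (S.χ * S.υ)) γ : ℂ)

theorem charSum_of_eq (h : S.χ * S.υ = S.β) : S.charSum = Fintype.card G := by
  simp [charSum, h]

theorem charSum_of_ne (h : S.χ * S.υ ≠ S.β) : S.charSum = 0 :=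
  sum_hom_units_eq_zero ((Units.coeHom ℂ).comp (S.β / (S.χ * S.υ))) fun h' =>
    h (div_eq_one.1 (MonoidHom.ext fun γ => Units.ext (DFunLike.congr_fun h' γ))).symm

theorem sum_multiplicity_quotient [Fintype I] [DecidableEq S.reps] (r : S.reps) :
    ∑ i with S.quotient.index i = r, S.quotient.multiplicity i = S.charSum := by
  refine Finset.sum_nbij' S.grp (· • (r : I)) (fun _ _ => Finset.mem_univ _)
    (fun γ _ => Finset.mem_filter.2 ⟨Finset.mem_univ _, S.rep_smul γ r⟩) (fun i hi => ?_)
    (fun γ _ => S.grp_smul γ r) fun i _ => S.multiplicity_quotient i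
  obtain rfl : S.rep i = r := (Finset.mem_filter.1 hi).2
  exact S.grp_smul_rep i

theorem correlator_eq_smul_extend [Fintype I] (g n : ℕ) (hgn : 2 ≤ 2 * g + n) :
    S.toCurve.correlator g n =
      S.charSum ^ (2 * g + n - 1) • S.extend (S.reduced.correlator g n) := by
  classical
  rw [← pullback_quotient]
  exact Curve.TwistedMap.correlator_eq S.sum_multiplicity_quotient g n hgn

end EquivariantCurve

end

end LocalTR

theorem mainTheorem7 {G I : Type*} [Group G] [Fintype G] [Fintype I] [MulAction G I]
    (S : LocalTR.EquivariantCurve G I) (g n : ℕ) (hgn : 0 < 2 * (g : ℤ) - 2 + ((n + 1 : ℕ) : ℤ)) :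
    (S.χ * S.υ ≠ S.β → S.toCurve.correlator g n = 0) ∧
    (S.χ * S.υ = S.β → ∀ v : Fin (n + 1) → I × ℤ,
      (S.toCurve.correlator g n).coeff v =
        (Fintype.card G : ℂ) ^ (2 * (g : ℤ) - 2 + ((n + 1 : ℕ) : ℤ)) *
          (S.extend (S.reduced.correlator g n)).coeff v) := by
  refine ⟨fun h => ?_, fun h v => ?_⟩
  · rw [S.correlator_eq_smul_extend g n (by omega), S.charSum_of_ne h, zero_pow (by omega),
      LocalTR.MultiDiff.zero_smul]
  · rw [S.correlator_eq_smul_extend g n (by omega), S.charSum_of_eq h, LocalTR.MultiDiff.coeff_smul,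
      show 2 * (g : ℤ) - 2 + ((n + 1 : ℕ) : ℤ) = ((2 * g + n - 1 : ℕ) : ℤ) by omega, zpow_natCast]
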